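/- A \emph{fighting fish} is a word on the alphabet $\{E,N,W,S\}$ that can be obtained from the word $ENWS$ by a finite (possibly empty) sequence of the following operations: replace one letter $W$ by $NWS$ (upper gluing); replace one letter $N$ by $ENW$ (lower gluing); replace one factor $WN$ (two consecutive letters) by $NW$ (double gluing). An \emph{extended fighting fish} is either the word $EVS$ (the empty fish) or a word on the alphabet $\{E,N,W,S,V\}$ obtained from a fighting fish by choosing a (possibly empty) set of occurrences of the factor $WN$ and replacing each chosen occurrence by the letter $V$. The \emph{size} of an extended fighting fish $F$ is $|F|_E+|F|_N-1$, where $|F|_a$ denotes the number of letters $a$ in $F$. \textbf{Corollary.} For every integer $n\ge 1$, the number of extended fighting fish of size $n$ is $$\frac{2}{n(n+1)}\binom{4n+1}{n-1}.$$ -/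

import Mathlib

namespace FightingFish

/-- The five step letters. `E` and `N` encode free left lower and right lower edges, `W` and `S`
free right upper and left upper edges, and `V` encodes a triangle filling a branch point. -/
inductive Letter where
  | E | N | W | S | V
  deriving DecidableEq

open Letter

/-- Words on the alphabet `{E, N, W, S, V}`. -/
abbrev Word := List Letter

/-- Fighting fish, as words on `{E, N, W, S}`: the words obtained from the head `ENWS` by finitely
many gluings. -/
inductive IsFightingFish : Word → Prop
  | head : IsFightingFish [E, N, W, S]
  /-- Upper gluing: replace one letter `W` by `NWS`. -/
  | upper (u v : Word) :
      IsFightingFish (u ++ [W] ++ v) → IsFightingFish (u ++ [N, W, S] ++ v)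
  /-- Lower gluing: replace one letter `N` by `ENW`. -/
  | lower (u v : Word) :
      IsFightingFish (u ++ [N] ++ v) → IsFightingFish (u ++ [E, N, W] ++ v)
  /-- Double gluing: replace one factor `WN` by `NW`. -/
  | double (u v : Word) :
      IsFightingFish (u ++ [W, N] ++ v) → IsFightingFish (u ++ [N, W] ++ v)

/-- `Fills w x`: the word `x` is obtained from `w` by choosing a set of occurrences of the factor
`WN` (unfilled branch points) and replacing each chosen occurrence by the letter `V`. -/
inductive Fills : Word → Word → Prop
  | nil : Fills [] []
  /-- a letter that is kept -/
  | keep (a : Letter) {w x : Word} : Fills w x → Fills (a :: w) (a :: x)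
  /-- a marked occurrence of `WN` -/
  | mark {w x : Word} : Fills w x → Fills (W :: N :: w) (V :: x)

/-- The empty fish `EVS` (a single triangle). -/
def emptyFish : Word := [E, V, S]

/-- Extended fighting fish: the empty fish, and the words obtained from a fighting fish by
replacing each of a set of marked unfilled branch points by `V`. -/
def IsExtendedFightingFish (x : Word) : Prop :=
  x = emptyFish ∨ ∃ w : Word, IsFightingFish w ∧ Fills w x

/-- The size: the number of free lower edges minus `1`. (Every extended fighting fish contains
the letter `E`, so that the subtraction is never truncated on these.) -/
def size (x : Word) : ℕ := x.count E + x.count N - 1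

/-- The set of extended fighting fish of size `n`. -/
def extendedFightingFish (n : ℕ) : Set Word :=
  {x | IsExtendedFightingFish x ∧ size x = n}

end FightingFish

/-!
A letter `V` stands for a factor `WN`, so a nonempty extended fighting fish is a word `x` such that
`expand x`, with these factors restored, is a fighting fish. The count has two halves: a bijection
of these words with labelled binary trees, and the solution of the functional equation of the trees.

*Fish and trees.* In a fighting fish the letters `E` and `W` are matched like parentheses, and so
are `N` and `S`; matched pairs are joined by strips of cells. Reading a word from left to right
while keeping the unmatched letters on a stack, and remembering which consecutive unmatched `N`s
are crossed by a common strip, gives a deterministic machine. Gluings respect its moves, so it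
accepts all fighting fish (`State.run_of_isFightingFish`). A parser that stores trees on the stack
follows the machine (`PState.exists_step`), so every fish is `E T W S^d`, where `T` is the word of a
tree of degree `d`. Here a tree is a sequence of factors; a factor is `N`, or `E T' V`, or
`E T' W S^k` with `k` less than the degree of the nonempty tree `T'`. Conversely `N^d` grows into
`T` by gluings (`Grows.word`), so all these words are fish, and since the parser is deterministic
the tree is unique.

*Counting.* Let `F(t; x)` count trees by number of nodes and by degree plus one. Cutting off the
last factor of the sequence gives (`LTree.degPoly_succ`)
`(x - 1) F(t; x) = x (x - 1) + t x F(t; x) (F(t; x) - F(t; 1))`,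
which is the known equation for intervals of Tamari lattices. It is solved by
`t = z (1 - z)^3`, `x = (1 + v) / (1 + z v)^2`,
`F = (1 + v) (1 - 2 z - z^2 v) / ((1 - z)^3 (1 + z v))` (`ParamSeries.sol_eq`), and the equation
determines `F` modulo each power of `z` (`ParamSeries.z_pow_dvd_sol_sub`). Since `v = 0` is `x = 1`,
`F(t; 1) = (1 - 2 z) / (1 - z)^3`. The series with the claimed coefficients has the same value at
`t = z (1 - z)^3` (`X_pow_dvd_sum_fishCount`): each coefficient of the identity beyond the first two
is an `m`-th finite difference of a polynomial of degree `m - 2`.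
-/

namespace FightingFish

open Letter

/-! ### A stack machine recognising fighting fish -/

/-- Configurations of the stack machine that reads a word from left to right. In a live
configuration `live L` the list `L` has, innermost first, one run of flags for each `E` not yet
matched with a `W`. A run lists, last one first, the `N`s that follow this `E` (and precede the next
unmatched `E`) and are not yet matched with an `S`; the flag of an `N` tells whether
some strip of cells, from an `E` to its `W`, crosses both this `N` and the previous one. In
`closed k` the first `E` has been matched, and `k` letters `N` wait for their `S`. -/
inductive State where
  | live (L : List (List Bool))
  | closed (k : ℕ)

namespace State

/-- One step of the stack machine, without the letter `V`. A `W` matches the innermost unmatched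
`E`; its strip crosses the whole run of that `E`, which must not be empty. An `S` matches the last
`N` and is allowed only if this does not pinch the surface at a vertex, i.e. if the flag of that
`N` is `true`. -/
def coreStep : State → Letter → Option State
  | live L, E => some (live ([] :: L))
  | live (r :: L), N => some (live ((false :: r) :: L))
  | live [_ :: r], W => some (closed (r.length + 1))
  | live ((_ :: r) :: r' :: L), W =>
      some (live ((List.replicate r.length true ++ false :: r') :: L))
  | live ((true :: r) :: L), S => some (live (r :: L))
  | closed (k + 1), S => some (closed k)
  | _, _ => none

/-- One step of the stack machine; `V` acts as the factor `WN` that it replaces. -/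
def step (σ : State) (a : Letter) : Option State :=
  if a = V then (σ.coreStep W).bind (·.coreStep N) else σ.coreStep a

/-- The configuration reached by reading a word. -/
def run (σ : State) (w : Word) : Option State := w.foldlM step σ

@[simp] lemma run_nil (σ : State) : σ.run [] = some σ := rfl

@[simp] lemma run_cons (σ : State) (a : Letter) (w : Word) :
    σ.run (a :: w) = (σ.step a).bind (·.run w) := rfl

lemma run_append (σ : State) (u v : Word) : σ.run (u ++ v) = (σ.run u).bind (·.run v) := by
  simp [run, List.foldlM_append]

/-- `σ ≤ τ`: the configurations have the same shape and each flag set in `σ` is set in `τ`. -/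
inductive Le : State → State → Prop
  | live {L M : List (List Bool)} : List.Forall₂ (List.Forall₂ (· ≤ ·)) L M → Le (live L) (live M)
  | closed (k : ℕ) : Le (closed k) (closed k)

lemma flags_le_refl (r : List Bool) : List.Forall₂ (· ≤ ·) r r :=
  List.forall₂_same.2 fun _ _ => le_rfl

lemma Le.refl : ∀ σ : State, Le σ σ
  | State.live _ => .live (List.forall₂_same.2 fun _ _ => flags_le_refl _)
  | State.closed k => .closed k

/-- Setting flags never blocks the machine. -/
lemma Le.coreStep {σ τ σ' : State} (h : Le σ τ) (a : Letter) (hs : σ.coreStep a = some σ') :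
    ∃ τ', τ.coreStep a = some τ' ∧ Le σ' τ' := by
  cases h with
  | closed k => exact ⟨σ', hs, Le.refl σ'⟩
  | live h =>
    cases a with
    | E =>
      simp only [State.coreStep, Option.some.injEq] at hs ⊢
      exact ⟨_, rfl, hs ▸ .live (.cons .nil h)⟩
    | N =>
      cases h with
      | nil => simp [State.coreStep] at hs
      | cons h1 h2 =>
        simp only [State.coreStep, Option.some.injEq] at hs ⊢
        exact ⟨_, rfl, hs ▸ .live (.cons (.cons le_rfl h1) h2)⟩
    | V => cases h <;> simp [State.coreStep] at hs
    | W =>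
      cases h with
      | nil => simp [State.coreStep] at hs
      | cons h1 h2 =>
        cases h1 with
        | nil => cases h2 <;> simp [State.coreStep] at hs
        | cons h3 h4 =>
          cases h2 with
          | nil =>
            simp only [State.coreStep, Option.some.injEq] at hs ⊢
            exact ⟨_, rfl, hs ▸ h4.length_eq ▸ .closed _⟩
          | cons h5 h6 =>
            simp only [State.coreStep, Option.some.injEq] at hs ⊢
            refine ⟨_, rfl, hs ▸ h4.length_eq ▸ .live (.cons ?_ h6)⟩
            exact List.rel_append (flags_le_refl _) (.cons le_rfl h5)
    | S =>
      cases h with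
      | nil => simp [State.coreStep] at hs
      | cons h1 h2 =>
        cases h1 with
        | nil => simp [State.coreStep] at hs
        | @cons x y _ _ h3 h4 =>
          cases x with
          | false => simp [State.coreStep] at hs
          | true =>
            obtain rfl : y = true := by revert h3; cases y <;> simp
            simp only [State.coreStep, Option.some.injEq] at hs ⊢
            exact ⟨_, rfl, hs ▸ .live (.cons h4 h2)⟩

lemma Le.step {σ τ σ' : State} (h : Le σ τ) (a : Letter) (hs : σ.step a = some σ') :
    ∃ τ', τ.step a = some τ' ∧ Le σ' τ' := by
  unfold State.step at hs ⊢
  split_ifs at hs ⊢ with ha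
  · obtain ⟨ρ, h1, h2⟩ := Option.bind_eq_some_iff.1 hs
    obtain ⟨ρ', h3, h4⟩ := h.coreStep _ h1
    obtain ⟨τ', h5, h6⟩ := h4.coreStep _ h2
    exact ⟨τ', by simp [h3, h5], h6⟩
  · exact h.coreStep a hs

lemma Le.run {w : Word} : ∀ {σ τ σ' : State}, Le σ τ → σ.run w = some σ' →
    ∃ τ', τ.run w = some τ' ∧ Le σ' τ' := by
  induction w with
  | nil => intro σ τ σ' h hs; exact ⟨τ, rfl, by simp at hs; exact hs ▸ h⟩
  | cons a w ih =>
    intro σ τ σ' h hs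
    obtain ⟨ρ, h1, h2⟩ := Option.bind_eq_some_iff.1 hs
    obtain ⟨ρ', h3, h4⟩ := h.step a h1
    obtain ⟨τ', h5, h6⟩ := ih h4 h2
    exact ⟨τ', by simp [h3, h5], h6⟩

/-- Replacing a factor `p` by a factor `q` keeps a word accepted, if from each configuration `q`
leads at least as high as `p`. -/
lemma run_replace {p q : Word}
    (hpq : ∀ σ σ' : State, σ.run p = some σ' → ∃ τ, σ.run q = some τ ∧ Le σ' τ)
    {σ : State} {k : ℕ} {u v : Word} (h : σ.run (u ++ p ++ v) = some (closed k)) :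
    σ.run (u ++ q ++ v) = some (closed k) := by
  simp only [run_append, Option.bind_eq_some_iff] at h ⊢
  obtain ⟨ρ, ⟨σ₁, h1, h2⟩, h3⟩ := h
  obtain ⟨τ, h4, h5⟩ := hpq _ _ h2
  obtain ⟨τ', h6, h7⟩ := h5.run h3
  cases h7
  exact ⟨τ, ⟨σ₁, h1, h4⟩, h6⟩

/-- The machine accepts every fighting fish: upper and lower gluings do not change the
configuration reached, and a double gluing only sets a flag. -/
lemma run_of_isFightingFish {w : Word} (h : IsFightingFish w) :
    (live []).run w = some (closed 0) := by
  induction h with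
  | head => rfl
  | upper u v _ ih =>
    refine run_replace (fun σ σ' h => ⟨σ', ?_, Le.refl _⟩) ih
    rcases σ with (_ | ⟨_ | ⟨b, r⟩, _ | ⟨r', L⟩⟩) | k <;>
      simp_all [step, coreStep, List.replicate_succ]
  | lower u v _ ih =>
    refine run_replace (fun σ σ' h => ⟨σ', ?_, Le.refl _⟩) ih
    rcases σ with (_ | ⟨r, L⟩) | k <;> simp_all [step, coreStep]
  | double u v _ ih =>
    refine run_replace (fun σ σ' h => ?_) ih
    rcases σ with (_ | ⟨_ | ⟨b, r⟩, _ | ⟨r', L⟩⟩) | k <;> simp [step, coreStep] at h ⊢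
    subst h
    refine .live (.cons ?_ ((List.forall₂_same.2 fun _ _ => flags_le_refl _)))
    rw [List.replicate_succ]
    exact .cons (by simp) (flags_le_refl _)

end State

/-! ### Marked branch points -/

/-- Replace each letter `V` by the factor `WN` that it stands for. -/
def expand (x : Word) : Word := x.flatMap fun a => if a = V then [W, N] else [a]

@[simp] lemma expand_nil : expand [] = [] := rfl

lemma expand_cons (a : Letter) (x : Word) :
    expand (a :: x) = (if a = V then [W, N] else [a]) ++ expand x := rfl

lemma expand_append (x y : Word) : expand (x ++ y) = expand x ++ expand y := by
  simp [expand]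

lemma expand_eq_self {x : Word} (h : V ∉ x) : expand x = x := by
  induction x with
  | nil => rfl
  | cons a x ih =>
    simp only [List.mem_cons, not_or] at h
    simp [expand_cons, ih h.2, Ne.symm h.1]

lemma fills_expand (x : Word) : Fills (expand x) x := by
  induction x with
  | nil => exact .nil
  | cons a x ih =>
    rw [expand_cons]
    split_ifs with h
    · exact h ▸ .mark ih
    · exact .keep a ih

lemma Fills.eq_expand {w x : Word} (h : Fills w x) (hw : V ∉ w) : w = expand x := by
  induction h with
  | nil => rfl
  | keep a _ ih =>
    simp only [List.mem_cons, not_or] at hw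
    simp [expand_cons, ← ih hw.2, Ne.symm hw.1]
  | mark _ ih =>
    simp only [List.mem_cons, not_or] at hw
    simp [expand_cons, ← ih hw.2.2]

lemma IsFightingFish.not_mem_V {w : Word} (h : IsFightingFish w) : V ∉ w := by
  induction h <;> simp_all

lemma isExtendedFightingFish_iff (x : Word) :
    IsExtendedFightingFish x ↔ x = emptyFish ∨ IsFightingFish (expand x) := by
  refine or_congr Iff.rfl ⟨?_, fun h => ⟨_, h, fills_expand x⟩⟩
  rintro ⟨w, hw, hx⟩
  exact hx.eq_expand hw.not_mem_V ▸ hw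

lemma State.run_expand (x : Word) : ∀ σ : State, σ.run (expand x) = σ.run x := by
  induction x with
  | nil => intro σ; rfl
  | cons a x ih =>
    intro σ
    rw [expand_cons]
    split_ifs with h
    · subst h
      rw [State.run_append, State.run_cons]
      simp only [ih, State.run_cons, State.run_nil]
      simp [State.step]
    · simp [ih]

/-! ### Trees and the words that they encode -/

/-- Binary trees with a natural number at each node; a tree stands for a sequence of factors of
words, and `node l r i` for the sequence `l` followed by one more factor, built from `r` and `i`. -/
inductive LTree where
  | nil
  | node (l r : LTree) (i : ℕ)
  deriving DecidableEq

namespace LTree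

/-- The number of nodes. -/
def nodes : LTree → ℕ
  | nil => 0
  | node l r _ => l.nodes + r.nodes + 1

/-- The number of letters `N` (or `V`) in the word of the tree that are not matched with an `S`. -/
def deg : LTree → ℕ
  | nil => 0
  | node l _ i => l.deg + (i + 1)

/-- Each label is at most the degree of the right subtree at its node. -/
def Valid : LTree → Prop
  | nil => True
  | node l r i => l.Valid ∧ r.Valid ∧ i ≤ r.deg

/-- The word of a tree. A node with empty right subtree contributes a single `N`. Otherwise it
contributes `E`, the word of the right subtree and then either `V` (largest label) or a `W`
followed by as many letters `S` as leave `i + 1` unmatched letters `N`. -/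
def word : LTree → Word
  | nil => []
  | node l nil _ => l.word ++ [N]
  | node l (node a b j) i => l.word ++ E :: ((node a b j).word ++
      if i = (node a b j).deg then [V]
      else W :: List.replicate ((node a b j).deg - 1 - i) S)

/-- The extended fighting fish of a tree. -/
def fish (t : LTree) : Word := E :: (t.word ++ W :: List.replicate t.deg S)

lemma word_node {l r : LTree} (i : ℕ) (hr : r ≠ nil) : (node l r i).word = l.word ++ E :: (r.word ++
      if i = r.deg then [V] else W :: List.replicate (r.deg - 1 - i) S) := by
  cases r with
  | nil => exact absurd rfl hr
  | node a b j => rw [word]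

lemma deg_pos {t : LTree} (h : t ≠ nil) : 0 < t.deg := by
  cases t with
  | nil => exact absurd rfl h
  | node l r i => simp [deg]

lemma count_word : ∀ t : LTree, t.word.count E + t.word.count N = t.nodes
  | nil => rfl
  | node l nil _ => by
    have := count_word l
    simp [word, nodes]; omega
  | node l (node a b j) i => by
    have h1 := count_word l
    have h2 := count_word (node a b j)
    rw [word, nodes]
    split_ifs <;> simp [List.count_replicate] at * <;> omega

lemma size_fish (t : LTree) : size t.fish = t.nodes := by
  have := count_word t
  simp [size, fish, List.count_replicate]; omega

end LTree

/-! ### Words of trees are fighting fish -/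

/-- `Grows p q`: inside every fighting fish, the factor `p` may be replaced by `q`. -/
def Grows (p q : Word) : Prop :=
  ∀ u v : Word, IsFightingFish (u ++ p ++ v) → IsFightingFish (u ++ q ++ v)

namespace Grows

lemma refl (p : Word) : Grows p p := fun _ _ h => h

lemma trans {p q r : Word} (h : Grows p q) (h' : Grows q r) : Grows p r :=
  fun u v hp => h' u v (h u v hp)

lemma append {p q p' q' : Word} (h : Grows p q) (h' : Grows p' q') :
    Grows (p ++ p') (q ++ q') := by
  intro u v hp
  have h1 := h u (p' ++ v) (by simpa using hp)
  simpa using h' (u ++ q) v (by simpa using h1)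

lemma append_left (a : Word) {p q : Word} (h : Grows p q) : Grows (a ++ p) (a ++ q) :=
  (refl a).append h

lemma append_right {p q : Word} (h : Grows p q) (a : Word) : Grows (p ++ a) (q ++ a) :=
  h.append (refl a)

lemma upper : Grows [W] [N, W, S] := IsFightingFish.upper
lemma lower : Grows [N] [E, N, W] := IsFightingFish.lower
lemma double : Grows [W, N] [N, W] := IsFightingFish.double

lemma W_replicate (k : ℕ) :
    Grows [W] (List.replicate k N ++ W :: List.replicate k S) := by
  induction k with
  | zero => exact refl _
  | succ k ih =>
    refine ih.trans ?_
    have := (upper.append_left (List.replicate k N)).append_right (List.replicate k S)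
    rw [List.replicate_succ']
    simpa [List.replicate_succ] using this

lemma W_comm_replicate (k : ℕ) : Grows (W :: List.replicate k N) (List.replicate k N ++ [W]) := by
  induction k with
  | zero => exact refl _
  | succ k ih =>
    have h1 := double.append_right (List.replicate k N)
    have h2 := ih.append_left [N]
    simpa [List.replicate_succ] using h1.trans h2

/-- A run of `N`s grows a strip of cells between a new `E` and a new `W`; the strip is then
prolonged by `k` cells, each adding an `N` before the `W` and an `S` behind it. -/
lemma replicate (i k : ℕ) : Grows (List.replicate (i + 1) N)
    (E :: (List.replicate (i + 1 + k) N ++ W :: List.replicate k S)) := by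
  have h1 := lower.append_right (List.replicate i N)
  have h2 := (W_comm_replicate i).append_left [E, N]
  have h3 := (W_replicate k).append_left (E :: N :: List.replicate i N)
  have h := h1.trans (h2.trans (by simpa using h3))
  rw [show i + 1 + k = (i + k) + 1 by omega, List.replicate_succ, List.replicate_succ,
    List.replicate_add, List.cons_append, List.append_assoc]
  exact h

/-- The word of a valid tree grows out of as many letters `N` as it has unmatched ones. -/
lemma word : ∀ t : LTree, t.Valid → Grows (List.replicate t.deg N) (expand t.word)
  | .nil, _ => refl _
  | .node l .nil i, h => by
    obtain rfl : i = 0 := by simpa [LTree.deg] using h.2.2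
    rw [LTree.word, LTree.deg, expand_append, List.replicate_add]
    exact (word l h.1).append (refl _)
  | .node l (.node a b j) i, h => by
    have hl := word l h.1
    have hr := word (.node a b j) h.2.1
    have hi := h.2.2
    have hpos : 0 < (LTree.node a b j).deg := LTree.deg_pos (by simp)
    rw [LTree.word, LTree.deg, expand_append, List.replicate_add]
    refine hl.append ?_
    generalize LTree.node a b j = r at *
    split_ifs with hir
    -- `N ^ (s + 1) N` grows into `E N ^ (s + 1) W N`, and then the inner run into the word of `r`
    · obtain ⟨s, hs⟩ := Nat.exists_eq_succ_of_ne_zero hpos.ne'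
      have h1 := (replicate s 0).append_right [N]
      have h2 := (hr.append_left [E]).append_right [W, N]
      subst hir
      simp only [hs, Nat.succ_eq_add_one, add_zero, List.replicate_zero] at h1 h2 ⊢
      rw [List.replicate_succ']
      simpa [expand_cons, expand_append] using h1.trans (by simpa using h2)
    · have hk : i + 1 + (r.deg - 1 - i) = r.deg := by omega
      have h1 := replicate i (r.deg - 1 - i)
      rw [hk] at h1
      have h2 := (hr.append_left [E]).append_right (W :: List.replicate (r.deg - 1 - i) S)
      have h3 := h1.trans (by simpa using h2)
      have h4 : expand (List.replicate (r.deg - 1 - i) S) = List.replicate (r.deg - 1 - i) S :=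
        expand_eq_self (by simp)
      simpa [expand_cons, expand_append, h4] using h3

end Grows

lemma LTree.isFightingFish_fish {t : LTree} (h : t.Valid) (ht : t ≠ .nil) :
    IsFightingFish (expand t.fish) := by
  obtain ⟨s, hs⟩ := Nat.exists_eq_succ_of_ne_zero (LTree.deg_pos ht).ne'
  have h1 := (Grows.W_replicate s).append_right [S] [E, N] [] .head
  have h2 := Grows.word t h [E] (W :: List.replicate t.deg S) (by
    rw [hs, List.replicate_succ (a := N), List.replicate_succ' (a := S)]
    simpa using h1)
  have h4 : expand (List.replicate t.deg S) = List.replicate t.deg S :=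
    expand_eq_self (by simp)
  simpa [LTree.fish, expand_cons, expand_append, h4] using h2

/-! ### Parsing words into trees -/

open LTree

/-- Configurations of the parser: `live L` holds, innermost first, the tree parsed so far behind
each `E` not yet matched with a `W` or `V`; `closed t k` is reached once the first `E` is matched,
when the tree is `t` and `k` letters `S` are still to come. -/
inductive PState where
  | live (L : List LTree)
  | closed (t : LTree) (k : ℕ)

namespace PState

/-- One step of the parser. -/
def step : PState → Letter → Option PState
  | live L, E => some (live (nil :: L))
  | live (t :: L), N => some (live (node t nil 0 :: L))
  | live [node a b j], W => some (closed (node a b j) (node a b j).deg)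
  | live (node a b j :: l :: L), W =>
      some (live (node l (node a b j) ((node a b j).deg - 1) :: L))
  | live (node a b j :: l :: L), V =>
      some (live (node l (node a b j) (node a b j).deg :: L))
  | live (node l r (i + 1) :: L), S =>
      if i + 1 < r.deg then some (live (node l r i :: L)) else none
  | closed t (k + 1), S => some (closed t k)
  | _, _ => none

/-- The configuration reached by reading a word. -/
def run (σ : PState) (w : Word) : Option PState := w.foldlM step σ

@[simp] lemma run_nil (σ : PState) : σ.run [] = some σ := rfl

@[simp] lemma run_cons (σ : PState) (a : Letter) (w : Word) :
    σ.run (a :: w) = (σ.step a).bind (·.run w) := rfl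

lemma run_append (σ : PState) (u v : Word) : σ.run (u ++ v) = (σ.run u).bind (·.run v) := by
  simp [run, List.foldlM_append]

lemma run_replicate_S (l r : LTree) (L : List LTree) (i : ℕ) : ∀ k : ℕ, i + k < r.deg →
    (live (node l r (i + k) :: L)).run (List.replicate k S) = some (live (node l r i :: L))
  | 0, _ => rfl
  | k + 1, h => by
    have := run_replicate_S l r L i k (by omega)
    rw [List.replicate_succ, run_cons, ← Nat.add_assoc, step, if_pos (by omega)]
    simpa using this

lemma run_closed_replicate_S (t : LTree) : ∀ k : ℕ,
    (closed t k).run (List.replicate k S) = some (closed t 0)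
  | 0 => rfl
  | k + 1 => by
    rw [List.replicate_succ, run_cons, step]
    simpa using run_closed_replicate_S t k

/-- Reading the word of a tree behind an unmatched `E` produces this tree. -/
lemma run_word : ∀ (t : LTree), t.Valid → ∀ L : List LTree,
    (live (nil :: L)).run t.word = some (live (t :: L))
  | nil, _, L => rfl
  | node l nil i, h, L => by
    obtain rfl : i = 0 := by simpa [LTree.deg] using h.2.2
    simp [word, run_append, run_word l h.1, step]
  | node l (node a b j) i, h, L => by
    have hpos : 0 < (node a b j).deg := LTree.deg_pos (by simp)
    have hi : i ≤ (node a b j).deg := h.2.2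
    rw [word, run_append, run_word l h.1]
    simp only [Option.bind_some, run_cons, step, run_append, run_word (node a b j) h.2.1]
    split_ifs with hir
    · simp [step, hir]
    · have h1 := run_replicate_S l (node a b j) L i ((node a b j).deg - 1 - i) (by omega)
      rw [show i + ((node a b j).deg - 1 - i) = (node a b j).deg - 1 by omega] at h1
      simpa [step] using h1

lemma run_fish {t : LTree} (h : t.Valid) (ht : t ≠ nil) :
    (live []).run t.fish = some (closed t 0) := by
  obtain ⟨a, b, j, rfl⟩ : ∃ a b j, t = node a b j := by
    cases t with
    | nil => exact absurd rfl ht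
    | node a b j => exact ⟨a, b, j, rfl⟩
  simp [fish, step, run_append, run_word _ h, run_closed_replicate_S]

/-- The word read so far in a configuration that holds a list of trees. -/
def prefixWord : List LTree → Word
  | [] => []
  | t :: L => prefixWord L ++ E :: t.word

/-- The flags of the last factor of the word of `node l r i`, put in front of `f`. Only the first
`N` of a factor has the flag `false`, except that in a factor ending with `V` so does the `N` hidden
in this `V`. -/
def nodeFlags (r : LTree) (i : ℕ) (f : List Bool) : List Bool :=
  if r ≠ nil ∧ i = r.deg then false :: (List.replicate (i - 1) true ++ false :: f)
  else List.replicate i true ++ false :: f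

/-- The run of flags that the stack machine holds where the parser holds a given tree. -/
def flags : LTree → List Bool
  | nil => []
  | node l r i => nodeFlags r i (flags l)

lemma length_flags {t : LTree} (h : t.Valid) : (flags t).length = t.deg := by
  induction t with
  | nil => rfl
  | node l r i ihl _ =>
    have := ihl h.1
    rw [flags, nodeFlags]
    split_ifs with hr
    · have := LTree.deg_pos hr.1
      simp [LTree.deg]; omega
    · simp [LTree.deg]; omega

/-- The configuration of the stack machine that corresponds to one of the parser. -/
def toState : PState → State
  | live L => .live (L.map flags)
  | closed _ k => .closed k

/-- The word `w` has been read and `σ` is what it parses to. -/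
def Parses (w : Word) : PState → Prop
  | live L => (∀ t ∈ L, t.Valid) ∧ w = prefixWord L
  | closed t k => t.Valid ∧ t ≠ nil ∧ k ≤ t.deg ∧
      w = E :: (t.word ++ W :: List.replicate (t.deg - k) S)

lemma exists_flags_eq_cons (l r : LTree) (i : ℕ) : ∃ b f, flags (node l r i) = b :: f := by
  cases h : flags (node l r i) with
  | nil => rw [flags, nodeFlags] at h; split_ifs at h; all_goals simp at h
  | cons b f => exact ⟨b, f, rfl⟩

lemma flags_word_W {l r : LTree} (hr : r ≠ nil) :
    flags (node l r (r.deg - 1)) = List.replicate (r.deg - 1) true ++ false :: flags l := by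
  have := LTree.deg_pos hr
  rw [flags, nodeFlags, if_neg (by omega)]

/-- The parser can follow each step of the stack machine. -/
lemma exists_step {w : Word} {σ : PState} (hσ : Parses w σ) {a : Letter} {τ : State}
    (h : σ.toState.step a = some τ) :
    ∃ σ', σ.step a = some σ' ∧ σ'.toState = τ ∧ Parses (w ++ [a]) σ' := by
  rcases σ with L | ⟨t, k⟩
  · obtain ⟨hL, rfl⟩ := hσ
    cases a with
    | E =>
      simp only [toState, State.step, State.coreStep, reduceCtorEq, if_false,
        Option.some.injEq] at h
      exact ⟨_, rfl, h, by simpa [Valid] using hL, by simp [prefixWord, word]⟩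
    | N =>
      rcases L with _ | ⟨t, L⟩
      · simp [toState, State.step, State.coreStep] at h
      · simp only [toState, State.step, State.coreStep, reduceCtorEq, if_false,
          Option.some.injEq, List.map_cons] at h
        refine ⟨_, rfl, by simpa [toState, flags, nodeFlags] using h, ?_,
          by simp [prefixWord, word]⟩
        simpa [Valid] using hL
    | W =>
      rcases L with _ | ⟨_ | ⟨a, b, j⟩, _ | ⟨l, L⟩⟩
      · simp [toState, State.step, State.coreStep] at h
      · simp [toState, State.step, State.coreStep, flags] at h
      · simp [toState, State.step, State.coreStep, flags] at h
      · have hv := hL (node a b j) (by simp)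
        have hlen := length_flags hv
        obtain ⟨c, f, hf⟩ := exists_flags_eq_cons a b j
        rw [hf] at hlen
        simp only [toState, State.step, State.coreStep, reduceCtorEq, if_false, hf,
          Option.some.injEq, List.map_cons, List.map_nil] at h
        refine ⟨_, rfl, ?_, hv, by simp, le_rfl, by simp [prefixWord]⟩
        rw [← h, toState, ← hlen, List.length_cons]
      · have hv := hL (node a b j) (by simp)
        have hlen := length_flags hv
        obtain ⟨c, f, hf⟩ := exists_flags_eq_cons a b j
        have hW := flags_word_W (l := l) (r := node a b j) (by simp)
        rw [hf] at hlen
        simp only [toState, State.step, State.coreStep, reduceCtorEq, if_false, hf,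
          Option.some.injEq, List.map_cons] at h
        have hpos : 0 < (node a b j).deg := LTree.deg_pos (by simp)
        refine ⟨_, rfl, ?_, ?_, ?_⟩
        · rw [← h, toState, List.map_cons, hW, ← hlen, List.length_cons, Nat.add_sub_cancel]
        · intro t ht
          rcases List.mem_cons.1 ht with rfl | ht
          · exact ⟨hL l (by simp), hv, by omega⟩
          · exact hL t (by simp [ht])
        · rw [prefixWord, prefixWord, prefixWord, word, if_neg (by omega)]
          simp
    | S =>
      rcases L with _ | ⟨_ | ⟨l, r, i⟩, L⟩
      · simp [toState, State.step, State.coreStep] at h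
      · simp [toState, State.step, State.coreStep, flags] at h
      · have hv := hL (node l r i) (by simp)
        have hi : i ≤ r.deg := hv.2.2
        rcases i with _ | i
        -- only one `N` of the last factor is unmatched; its flag is `false`
        · have : flags (node l r 0) = false :: flags l := by
            rw [flags, nodeFlags, if_neg]
            · rfl
            · rintro ⟨h1, h2⟩
              exact (LTree.deg_pos h1).ne h2
          simp [toState, State.step, State.coreStep, this] at h
        · have hr : r ≠ nil := by rintro rfl; simp [LTree.deg] at hi
          by_cases hir : i + 1 = r.deg
          -- the last factor ends with `V`, and the `N` hidden in it has the flag `false`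
          · simp [toState, State.step, State.coreStep, flags, nodeFlags, hr, hir] at h
          · have hlt : i + 1 < r.deg := by omega
            have h0 : flags (node l r i) = List.replicate i true ++ false :: flags l := by
              rw [flags, nodeFlags, if_neg (by omega)]
            have h1 : flags (node l r (i + 1)) = true :: flags (node l r i) := by
              rw [h0, flags, nodeFlags, if_neg (by omega)]; rfl
            simp only [toState, State.step, State.coreStep, reduceCtorEq, if_false, h1,
              Option.some.injEq, List.map_cons] at h
            refine ⟨_, if_pos hlt, h, ?_, ?_⟩
            · intro t ht
              rcases List.mem_cons.1 ht with rfl | ht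
              · exact ⟨hv.1, hv.2.1, by omega⟩
              · exact hL t (by simp [ht])
            · rw [prefixWord, prefixWord, word_node _ hr, word_node _ hr, if_neg (by omega),
                if_neg (by omega), show r.deg - 1 - i = (r.deg - 1 - (i + 1)) + 1 by omega,
                List.replicate_succ']
              simp
    | V =>
      rcases L with _ | ⟨_ | ⟨a, b, j⟩, _ | ⟨l, L⟩⟩
      · simp [toState, State.step, State.coreStep] at h
      · simp [toState, State.step, State.coreStep, flags] at h
      · simp [toState, State.step, State.coreStep, flags] at h
      · obtain ⟨c, f, hf⟩ := exists_flags_eq_cons a b j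
        simp [toState, State.step, State.coreStep, hf] at h
      · have hv := hL (node a b j) (by simp)
        have hlen := length_flags hv
        obtain ⟨c, f, hf⟩ := exists_flags_eq_cons a b j
        rw [hf] at hlen
        simp only [toState, State.step, State.coreStep, if_true, hf, Option.bind_some,
          Option.some.injEq, List.map_cons] at h
        refine ⟨_, rfl, ?_, ?_, ?_⟩
        · rw [← h, toState, List.map_cons, flags, nodeFlags, if_pos (by simp), ← hlen,
            List.length_cons, Nat.add_sub_cancel]
        · intro t ht
          rcases List.mem_cons.1 ht with rfl | ht
          · exact ⟨hL l (by simp), hv, le_rfl⟩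
          · exact hL t (by simp [ht])
        · rw [prefixWord, prefixWord, prefixWord, word, if_pos rfl]
          simp
  · obtain ⟨hv, hne, hk, rfl⟩ := hσ
    rcases k with _ | k
    · cases a <;> simp [toState, State.step, State.coreStep] at h
    · cases a <;> simp [toState, State.step, State.coreStep] at h
      refine ⟨_, rfl, h, hv, hne, by omega, ?_⟩
      rw [show t.deg - k = (t.deg - (k + 1)) + 1 by omega, List.replicate_succ']
      simp

lemma exists_run {v : Word} : ∀ {w : Word} {σ : PState} {τ : State}, Parses w σ →
    σ.toState.run v = some τ → ∃ σ', σ'.toState = τ ∧ Parses (w ++ v) σ' := by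
  induction v with
  | nil => intro w σ τ hσ h; exact ⟨σ, by simpa using h, by simpa using hσ⟩
  | cons a v ih =>
    intro w σ τ hσ h
    obtain ⟨ρ, h1, h2⟩ := Option.bind_eq_some_iff.1 h
    obtain ⟨σ', -, rfl, h3⟩ := exists_step hσ h1
    obtain ⟨σ'', h4, h5⟩ := ih h3 h2
    exact ⟨σ'', h4, by simpa using h5⟩

end PState

lemma isFightingFish_expand_iff (x : Word) :
    IsFightingFish (expand x) ↔ ∃ t : LTree, t.Valid ∧ t ≠ .nil ∧ t.fish = x := by
  constructor
  · intro h
    have h1 := State.run_of_isFightingFish h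
    rw [State.run_expand] at h1
    obtain ⟨σ, h2, h3⟩ := PState.exists_run (w := []) (σ := .live []) (by simp [PState.Parses,
      PState.prefixWord]) h1
    rcases σ with L | ⟨t, k⟩
    · simp [PState.toState] at h2
    · obtain rfl : k = 0 := by simpa [PState.toState] using h2
      exact ⟨t, h3.1, h3.2.1, by simpa [fish] using h3.2.2.2.symm⟩
  · rintro ⟨t, ht, hne, rfl⟩
    exact isFightingFish_fish ht hne

lemma LTree.fish_injective {t t' : LTree} (h : t.Valid) (hne : t ≠ nil) (h' : t'.Valid)
    (hne' : t' ≠ nil) (heq : t.fish = t'.fish) : t = t' := by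
  have h1 := PState.run_fish h hne
  rw [heq, PState.run_fish h' hne'] at h1
  simpa using h1.symm

lemma extendedFightingFish_eq_image {n : ℕ} (hn : 1 ≤ n) :
    extendedFightingFish n = LTree.fish '' {t | t.Valid ∧ t.nodes = n} := by
  ext x
  simp only [extendedFightingFish, Set.mem_ofPred_eq, Set.mem_image, isExtendedFightingFish_iff,
    isFightingFish_expand_iff]
  constructor
  · rintro ⟨rfl | ⟨t, ht, hne, rfl⟩, hx⟩
    -- the empty fish has size `0`
    · have : size emptyFish = 0 := rfl
      omega
    · exact ⟨t, ⟨ht, by rwa [size_fish] at hx⟩, rfl⟩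
  · rintro ⟨t, ⟨ht, htn⟩, rfl⟩
    refine ⟨.inr ⟨t, ht, ?_, rfl⟩, by rwa [size_fish]⟩
    rintro rfl
    simp [LTree.nodes] at htn
    omega

lemma ncard_extendedFightingFish {n : ℕ} (hn : 1 ≤ n) :
    (extendedFightingFish n).ncard = {t : LTree | t.Valid ∧ t.nodes = n}.ncard := by
  rw [extendedFightingFish_eq_image hn]
  refine Set.InjOn.ncard_image ?_
  have hne : ∀ t : LTree, t.nodes = n → t ≠ .nil := by
    rintro _ h rfl
    simp [LTree.nodes] at h
    omega
  rintro t ⟨ht, htn⟩ t' ⟨ht', htn'⟩ heq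
  exact fish_injective ht (hne t htn) ht' (hne t' htn') heq

/-! ### Counting the trees -/

namespace LTree

open Finset Polynomial

/-- The valid trees with `n` nodes. -/
def trees : ℕ → Finset LTree
  | 0 => {nil}
  | n + 1 => (antidiagonal n).attach.biUnion fun p =>
      have := Nat.lt_succ_of_le (HasAntidiagonal.antidiagonal.fst_le p.2)
      have := Nat.lt_succ_of_le (HasAntidiagonal.antidiagonal.snd_le p.2)
      (trees p.1.1).biUnion fun l => (trees p.1.2).biUnion fun r =>
        (range (r.deg + 1)).image (node l r)
  decreasing_by all_goals simp_wf; omega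

lemma mem_trees {t : LTree} : ∀ {n : ℕ}, t ∈ trees n ↔ t.Valid ∧ t.nodes = n := by
  induction t with
  | nil =>
    intro n
    cases n <;> simp [trees, Valid, nodes]
  | node l r i ihl ihr =>
    intro n
    cases n with
    | zero => simp [trees, nodes]
    | succ n =>
      simp only [trees, mem_biUnion, mem_attach, true_and, Subtype.exists, mem_image, mem_range,
        node.injEq, Prod.exists, HasAntidiagonal.mem_antidiagonal, Valid, nodes]
      constructor
      · rintro ⟨a, b, hab, l', hl, r', hr, j, hj, rfl, rfl, rfl⟩
        have h1 := ihl.1 hl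
        have h2 := ihr.1 hr
        exact ⟨⟨h1.1, h2.1, by omega⟩, by omega⟩
      · rintro ⟨⟨h1, h2, h3⟩, h4⟩
        exact ⟨l.nodes, r.nodes, by omega, l, ihl.2 ⟨h1, rfl⟩, r, ihr.2 ⟨h2, rfl⟩, i, by omega,
          rfl, rfl, rfl⟩

lemma setOf_valid_eq_trees (n : ℕ) : {t : LTree | t.Valid ∧ t.nodes = n} = trees n := by
  ext t
  simp [mem_trees]

/-- The generating polynomial of the valid trees with `n` nodes by degree plus one. -/
noncomputable def degPoly (n : ℕ) : ℚ[X] := ∑ t ∈ trees n, X ^ (t.deg + 1)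

lemma eval_one_degPoly (n : ℕ) : (degPoly n).eval 1 = (#(trees n) : ℚ) := by
  simp [degPoly, eval_finsetSum]

lemma degPoly_zero : degPoly 0 = X := by simp [degPoly, trees, deg]

lemma sum_trees_succ {M : Type*} [AddCommMonoid M] (f : LTree → M) (n : ℕ) :
    ∑ t ∈ trees (n + 1), f t = ∑ p ∈ antidiagonal n, ∑ l ∈ trees p.1, ∑ r ∈ trees p.2,
      ∑ i ∈ range (r.deg + 1), f (node l r i) := by
  have h : trees (n + 1) = ((antidiagonal n).sigma fun p => (trees p.1).sigma fun _ =>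
      (trees p.2).sigma fun r => range (r.deg + 1)).image
        fun q => node q.2.1 q.2.2.1 q.2.2.2 := by
    ext t
    simp only [mem_trees, mem_image, mem_sigma, HasAntidiagonal.mem_antidiagonal, mem_range, Sigma.exists,
      Prod.exists]
    constructor
    · rintro ⟨hv, hn⟩
      cases t with
      | nil => simp [nodes] at hn
      | node l r i =>
        simp only [nodes] at hn
        exact ⟨l.nodes, r.nodes, l, r, i, ⟨by omega, ⟨hv.1, rfl⟩, ⟨hv.2.1, rfl⟩,
          Nat.lt_succ_of_le hv.2.2⟩, rfl⟩
    · rintro ⟨a, b, l, r, i, ⟨hab, ⟨hl, rfl⟩, ⟨hr, rfl⟩, hi⟩, rfl⟩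
      exact ⟨⟨hl, hr, by omega⟩, by simp only [nodes]; omega⟩
  rw [h, sum_image]
  · simp only [sum_sigma]
  · rintro ⟨⟨a, b⟩, l, r, i⟩ hq ⟨⟨a', b'⟩, l', r', i'⟩ hq' heq
    simp only [node.injEq] at heq
    obtain ⟨rfl, rfl, rfl⟩ := heq
    simp only [coe_sigma, Set.mem_sigma_iff, mem_coe, mem_trees] at hq hq'
    obtain ⟨-, ⟨-, rfl⟩, ⟨-, rfl⟩, -⟩ := hq
    obtain ⟨-, ⟨-, rfl⟩, ⟨-, rfl⟩, -⟩ := hq'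
    rfl

/-- The functional equation with one catalytic variable: the labels at the root of
`node l r i` contribute a geometric sum. -/
lemma degPoly_succ (n : ℕ) : (X - 1) * degPoly (n + 1) =
    X * ∑ p ∈ antidiagonal n, degPoly p.1 * (degPoly p.2 - C ((degPoly p.2).eval 1)) := by
  have hgeom : ∀ l r : LTree, (X - 1) * ∑ i ∈ range (r.deg + 1), (X : ℚ[X]) ^ ((node l r i).deg + 1)
      = X * (X ^ (l.deg + 1) * (X ^ (r.deg + 1) - 1)) := by
    intro l r
    have h := mul_geom_sum (X : ℚ[X]) (r.deg + 1)
    have h2 : ∑ i ∈ range (r.deg + 1), (X : ℚ[X]) ^ ((node l r i).deg + 1) =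
        X ^ (l.deg + 2) * ∑ i ∈ range (r.deg + 1), (X : ℚ[X]) ^ i := by
      rw [mul_sum]
      refine sum_congr rfl fun i _ => ?_
      rw [← pow_add, deg]
      congr 1
      omega
    rw [h2, mul_left_comm, h]
    ring
  have hsub : ∀ m : ℕ, degPoly m - C ((degPoly m).eval 1) =
      ∑ r ∈ trees m, (X ^ (r.deg + 1) - 1) := by
    intro m
    rw [eval_one_degPoly, sum_sub_distrib, degPoly]
    simp
  rw [degPoly, sum_trees_succ]
  rw [mul_sum, mul_sum]
  refine sum_congr rfl fun p _ => ?_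
  rw [hsub, degPoly, sum_mul_sum, mul_sum, mul_sum]
  refine sum_congr rfl fun l _ => ?_
  rw [mul_sum, mul_sum]
  exact sum_congr rfl fun r _ => hgeom l r

end LTree

/-! ### Coefficients of the univariate series -/

section Coefficients

open Finset

/-- The claimed number of extended fighting fish of size `n`, with value `1` at `n = 0`. -/
def fishCount (n : ℕ) : ℚ := 2 * (4 * n + 1).factorial / ((n + 1).factorial * (3 * n + 2).factorial)

lemma fishCount_eq {n : ℕ} (hn : 1 ≤ n) :
    fishCount n = 2 / ((n : ℚ) * ((n : ℚ) + 1)) * ((4 * n + 1).choose (n - 1) : ℚ) := by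
  obtain ⟨n, rfl⟩ := Nat.exists_eq_add_of_le' hn
  rw [Nat.cast_choose ℚ (by omega), fishCount,
    show 4 * (n + 1) + 1 - (n + 1 - 1) = 3 * (n + 1) + 2 by omega, Nat.add_sub_cancel,
    Nat.factorial_succ (n + 1), Nat.factorial_succ n]
  have := Nat.factorial_ne_zero n
  have := Nat.factorial_ne_zero (3 * (n + 1) + 2)
  push_cast
  field_simp

/-- Up to a factor independent of `n`, the left-hand side is `m.choose n` times a polynomial in `n`
of degree `m - 2`. -/
lemma fishCount_mul_choose {m n : ℕ} (hm : 2 ≤ m) (hn : n ≤ m) :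
    fishCount n * ((3 * n + 3).choose (m - n) : ℚ) =
      6 / m.factorial * (m.choose n * ((4 * n + 1).descFactorial (m - 2) : ℚ)) := by
  by_cases h : m - n ≤ 3 * n + 3
  · have h1 : ((4 * n + 1).descFactorial (m - 2) : ℚ) * (4 * n + 3 - m).factorial =
        (4 * n + 1).factorial := by
      have := Nat.factorial_mul_descFactorial (n := 4 * n + 1) (k := m - 2) (by omega)
      rw [show 4 * n + 1 - (m - 2) = 4 * n + 3 - m by omega] at this
      rw [mul_comm]
      exact_mod_cast this
    rw [Nat.cast_choose ℚ h, Nat.cast_choose ℚ hn, fishCount, ← h1,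
      show 3 * n + 3 - (m - n) = 4 * n + 3 - m by omega,
      Nat.factorial_succ (3 * n + 2), Nat.factorial_succ n]
    have := Nat.factorial_ne_zero n
    have := Nat.factorial_ne_zero m
    have := Nat.factorial_ne_zero (m - n)
    have := Nat.factorial_ne_zero (3 * n + 2)
    have := Nat.factorial_ne_zero (4 * n + 3 - m)
    push_cast
    field_simp
    ring
  · rw [Nat.choose_eq_zero_of_lt (by omega), Nat.descFactorial_eq_zero_iff_lt.2 (by omega)]
    simp

lemma sum_fishCount_mul_choose {m : ℕ} (hm : 2 ≤ m) :
    ∑ n ∈ range (m + 1), fishCount n * ((-1) ^ (m - n) * ((3 * n + 3).choose (m - n) : ℚ)) = 0 := by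
  set P : Polynomial ℚ := (descPochhammer ℚ (m - 2)).comp (4 * Polynomial.X + 1) with hP
  have hdeg : P.natDegree < m := by
    have h1 : (4 * Polynomial.X + 1 : Polynomial ℚ).natDegree = 1 := by
      exact Polynomial.natDegree_linear (a := (4 : ℚ)) (b := 1) (by norm_num)
    rw [hP, Polynomial.natDegree_comp, descPochhammer_natDegree, h1]
    omega
  have h0 := congrFun (Polynomial.fwdDiff_iter_eq_zero_of_degree_lt hdeg) 0
  rw [fwdDiff_iter_eq_sum_shift] at h0
  have heval : ∀ n : ℕ, P.eval (n : ℚ) = ((4 * n + 1).descFactorial (m - 2) : ℚ) := by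
    intro n
    rw [hP, Polynomial.eval_comp, ← descPochhammer_eval_eq_descFactorial]
    simp
  have : ∑ n ∈ range (m + 1), fishCount n * ((-1) ^ (m - n) * ((3 * n + 3).choose (m - n) : ℚ)) =
      6 / m.factorial * ∑ n ∈ range (m + 1),
        ((-1 : ℤ) ^ (m - n) * m.choose n) • P.eval ((0 : ℚ) + n • 1) := by
    rw [mul_sum]
    refine sum_congr rfl fun n hn => ?_
    have := fishCount_mul_choose hm (Nat.lt_succ_iff.1 (mem_range.1 hn))
    rw [zero_add, nsmul_one, heval, zsmul_eq_mul, mul_left_comm, this]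
    push_cast
    ring
  rw [this, h0]
  simp

open PowerSeries in
lemma coeff_one_sub_X_pow (d k : ℕ) :
    coeff k ((1 - X : PowerSeries ℚ) ^ d) = (-1) ^ k * (d.choose k : ℚ) := by
  have h : (1 - X : PowerSeries ℚ) ^ d =
      rescale (-1) (((1 + Polynomial.X : Polynomial ℚ) ^ d : Polynomial ℚ) : PowerSeries ℚ) := by
    simp [sub_eq_add_neg]
  rw [h, coeff_rescale, Polynomial.coeff_coe, Polynomial.coeff_one_add_X_pow]

open PowerSeries in
/-- The series of the `fishCount n`, at `X * (1 - X) ^ 3`, is `(1 - 2 * X) / (1 - X) ^ 3`. -/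
lemma X_pow_dvd_sum_fishCount (N : ℕ) : (X : PowerSeries ℚ) ^ N ∣
    (1 - X) ^ 3 * ∑ n ∈ range N, C (fishCount n) * (X * (1 - X) ^ 3) ^ n - (1 - 2 * X) := by
  rw [X_pow_dvd_iff]
  intro m hm
  have hmul : ∀ n : ℕ, (1 - X : PowerSeries ℚ) ^ 3 * (C (fishCount n) * (X * (1 - X) ^ 3) ^ n) =
      C (fishCount n) * (X ^ n * (1 - X) ^ (3 * n + 3)) := by
    intro n
    rw [mul_pow, ← pow_mul, pow_add]
    ring
  have key : coeff m ((1 - X : PowerSeries ℚ) ^ 3 *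
      ∑ n ∈ range N, C (fishCount n) * (X * (1 - X) ^ 3) ^ n) =
      ∑ n ∈ range (m + 1), fishCount n * ((-1) ^ (m - n) * ((3 * n + 3).choose (m - n) : ℚ)) := by
    rw [mul_sum, map_sum, ← sum_subset (range_subset_range.2 hm)]
    · refine sum_congr rfl fun n hn => ?_
      have hn' : n ≤ m := Nat.lt_succ_iff.1 (mem_range.1 hn)
      rw [hmul, coeff_C_mul, coeff_X_pow_mul', if_pos hn', coeff_one_sub_X_pow]
    · intro n _ hn
      have hn' : ¬ n ≤ m := by simpa using hn
      rw [hmul, coeff_C_mul, coeff_X_pow_mul', if_neg hn', mul_zero]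
  rw [map_sub, key]
  have h2 : (1 - 2 * X : PowerSeries ℚ) = C 1 - C 2 * X := by
    rw [map_one, map_ofNat]
  rcases m with _ | _ | m
  · simp [fishCount, h2]
  · rw [h2]
    simp [fishCount, sum_range_succ, coeff_C, Nat.factorial]
    norm_num
  · rw [sum_fishCount_mul_choose (by omega), h2]
    simp

end Coefficients

/-! ### Solving the functional equation -/

section Parametrization

open Finset PowerSeries

/-- The product of two truncated series, modulo the truncation order. -/
lemma pow_dvd_sum_mul_sum_sub {R : Type*} [CommRing R] (a b : ℕ → R) (t : R) (N : ℕ) :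
    t ^ N ∣ (∑ n ∈ range N, a n * t ^ n) * (∑ n ∈ range N, b n * t ^ n) -
      ∑ n ∈ range N, (∑ p ∈ antidiagonal n, a p.1 * b p.2) * t ^ n := by
  let P : (ℕ → R) → Polynomial R := fun a => ∑ n ∈ range N, Polynomial.C (a n) * Polynomial.X ^ n
  have hcoeff : ∀ (a : ℕ → R) (n : ℕ), n < N → (P a).coeff n = a n := by
    intro a n hn
    simp only [P, Polynomial.finsetSum_coeff, Polynomial.coeff_C_mul_X_pow]
    simp [hn]
  have heval : ∀ a : ℕ → R, (P a).eval t = ∑ n ∈ range N, a n * t ^ n := by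
    intro a
    simp [P, Polynomial.eval_finsetSum]
  have h : (Polynomial.X : Polynomial R) ^ N ∣
      P a * P b - P fun n => ∑ p ∈ antidiagonal n, a p.1 * b p.2 := by
    rw [Polynomial.X_pow_dvd_iff]
    intro n hn
    rw [Polynomial.coeff_sub, hcoeff _ _ hn, Polynomial.coeff_mul, sub_eq_zero]
    refine sum_congr rfl fun p hp => ?_
    have hp' := HasAntidiagonal.mem_antidiagonal.1 hp
    rw [hcoeff _ _ (by omega), hcoeff _ _ (by omega)]
  have h2 := Polynomial.eval_dvd (x := t) h
  simpa only [Polynomial.eval_pow, Polynomial.eval_X, Polynomial.eval_sub, Polynomial.eval_mul,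
    heval] using h2

/-- Series in the parameter `z`, whose coefficients are polynomials in the parameter `v`. -/
abbrev ParamSeries : Type := PowerSeries (Polynomial ℚ)

namespace ParamSeries

/-- The parameter `z`. -/
noncomputable def z : ParamSeries := X

/-- The parameter `v`. -/
noncomputable def v : ParamSeries := C Polynomial.X

/-- The series `1 / (1 + z * v)`. -/
noncomputable def w : ParamSeries := invOfUnit (1 + z * v) 1

/-- The series `1 / (1 - z)`. -/
noncomputable def r : ParamSeries := invOfUnit (1 - z) 1

lemma mul_w : (1 + z * v) * w = 1 := mul_invOfUnit _ _ (by simp [z])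

lemma mul_r : (1 - z) * r = 1 := mul_invOfUnit _ _ (by simp [z])

/-- The series substituted for the size variable. -/
noncomputable def t : ParamSeries := z * (1 - z) ^ 3

/-- The series substituted for the catalytic variable. -/
noncomputable def x : ParamSeries := (1 + v) * w ^ 2

/-- The value of the bivariate generating function of trees. -/
noncomputable def sol : ParamSeries := (1 + v) * (1 - 2 * z - z ^ 2 * v) * r ^ 3 * w

/-- The value of `sol` at `v = 0`. -/
noncomputable def solAtOne : ParamSeries := (1 - 2 * z) * r ^ 3

/-- Setting `v = 0`; this specialises the catalytic variable `x` to `1`. -/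
noncomputable def atZero : ParamSeries →ₐ[ℚ] ParamSeries :=
  mapAlgHom ((Algebra.ofId ℚ (Polynomial ℚ)).comp (Polynomial.aeval (0 : ℚ)))

lemma atZero_z : atZero z = z := by simp [atZero, z, mapAlgHom_apply]

lemma atZero_v : atZero v = 0 := by simp [atZero, v, mapAlgHom_apply]

lemma atZero_w : atZero w = 1 := by
  simpa [atZero_z, atZero_v] using congrArg atZero mul_w

lemma atZero_r : atZero r = r := by
  have h := congrArg atZero mul_r
  simp only [map_mul, map_sub, map_one, atZero_z] at h
  linear_combination r * h - atZero r * mul_r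

lemma atZero_t : atZero t = t := by simp [t, atZero_z]

lemma atZero_x : atZero x = 1 := by simp [x, atZero_v, atZero_w]

lemma atZero_sol : atZero sol = solAtOne := by
  simp [sol, solAtOne, atZero_v, atZero_w, atZero_r, atZero_z, map_ofNat]

lemma not_z_dvd_x_sub_one : ¬ z ∣ x - 1 := by
  have hw := congrArg constantCoeff mul_w
  simp only [map_mul, map_add, map_one, z, constantCoeff_X, zero_mul, add_zero, one_mul] at hw
  rw [z, X_dvd_iff]
  simp [x, hw, v]

/-- The parametrization solves the functional equation. -/
lemma sol_eq : (x - 1) * sol = x * (x - 1) + x * t * (sol * (sol - solAtOne)) := by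
  have hx : x - 1 = v * (1 - 2 * z - z ^ 2 * v) * w ^ 2 := by
    rw [x]
    linear_combination ((1 + z * v) * w + 1) * mul_w
  have ht : t * (sol - solAtOne) = z * v * (1 - 3 * z + z ^ 2 - z ^ 2 * v) * w := by
    have hr : (1 - z) ^ 3 * r ^ 3 = 1 := by rw [← mul_pow, mul_r, one_pow]
    rw [t, sol, solAtOne]
    linear_combination z * ((1 + v) * (1 - 2 * z - z ^ 2 * v) * w - (1 - 2 * z)) * hr +
      z * (1 - 2 * z) * mul_w
  have hs : sol - x = (1 + v) * w ^ 2 * (z * (1 + v) * (1 - 3 * z + z ^ 2 - z ^ 2 * v)) * r ^ 3 := by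
    have hr : (1 - z) ^ 3 * r ^ 3 = 1 := by rw [← mul_pow, mul_r, one_pow]
    rw [sol, x]
    linear_combination (1 + v) * w ^ 2 * hr -
      (1 + v) * (1 - 2 * z - z ^ 2 * v) * r ^ 3 * w * mul_w
  calc (x - 1) * sol = x * (x - 1) + (x - 1) * (sol - x) := by ring
    _ = x * (x - 1) + x * sol * (t * (sol - solAtOne)) := by
      rw [hs, ht, hx, x, sol]
      ring
    _ = _ := by ring

open LTree

/-- The bivariate generating function of trees with fewer than `N` nodes, at the
parametrization. -/
noncomputable def partialSum (N : ℕ) : ParamSeries :=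
  ∑ n ∈ range N, Polynomial.aeval x (degPoly n) * t ^ n

/-- The univariate generating function of trees with fewer than `N` nodes, at the
parametrization. -/
noncomputable def partialSumAtOne (N : ℕ) : ParamSeries :=
  ∑ n ∈ range N, algebraMap ℚ ParamSeries ((degPoly n).eval 1) * t ^ n

lemma atZero_partialSum (N : ℕ) : atZero (partialSum N) = partialSumAtOne N := by
  simp only [partialSum, partialSumAtOne, map_sum, map_mul, map_pow, atZero_t]
  refine sum_congr rfl fun n _ => ?_
  rw [← Polynomial.aeval_algHom_apply, atZero_x, ← map_one (algebraMap ℚ ParamSeries),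
    Polynomial.aeval_algebraMap_apply_eq_algebraMap_eval]

/-- The coefficients, in the size variable, of the quadratic term of the functional equation. -/
noncomputable def quadCoeff (n : ℕ) : ParamSeries :=
  ∑ p ∈ antidiagonal n, Polynomial.aeval x (degPoly p.1) *
    (Polynomial.aeval x (degPoly p.2) - algebraMap ℚ ParamSeries ((degPoly p.2).eval 1))

lemma sub_one_mul_aeval_degPoly_succ (n : ℕ) :
    (x - 1) * Polynomial.aeval x (degPoly (n + 1)) = x * quadCoeff n := by
  have h := congrArg (Polynomial.aeval x) (degPoly_succ n)
  simp only [map_mul, map_sub, map_sum, map_one, Polynomial.aeval_X, Polynomial.aeval_C] at h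
  exact h

lemma sub_one_mul_partialSum (N : ℕ) : (x - 1) * partialSum (N + 1) =
    x * (x - 1) + x * t * ∑ n ∈ range N, quadCoeff n * t ^ n := by
  have h : (x - 1) * ∑ n ∈ range N, Polynomial.aeval x (degPoly (n + 1)) * t ^ (n + 1) =
      x * t * ∑ n ∈ range N, quadCoeff n * t ^ n := by
    rw [mul_sum, mul_sum]
    refine sum_congr rfl fun n _ => ?_
    rw [← mul_assoc, sub_one_mul_aeval_degPoly_succ, pow_succ]
    ring
  rw [partialSum, sum_range_succ', mul_add, h, degPoly_zero, Polynomial.aeval_X, pow_zero]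
  ring

lemma z_dvd_t : z ∣ t := Dvd.intro _ rfl

lemma z_pow_dvd_sub_quadCoeff (N : ℕ) : z ^ N ∣
    partialSum N * (partialSum N - partialSumAtOne N) - ∑ n ∈ range N, quadCoeff n * t ^ n := by
  have h := pow_dvd_sum_mul_sum_sub (fun n => Polynomial.aeval x (degPoly n))
    (fun n => Polynomial.aeval x (degPoly n) -
      algebraMap ℚ ParamSeries ((degPoly n).eval 1)) t N
  have hsub : ∑ n ∈ range N, (Polynomial.aeval x (degPoly n) -
      algebraMap ℚ ParamSeries ((degPoly n).eval 1)) * t ^ n =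
      partialSum N - partialSumAtOne N := by
    simp only [partialSum, partialSumAtOne, sub_mul, sum_sub_distrib]
  rw [hsub] at h
  exact (pow_dvd_pow_of_dvd z_dvd_t N).trans h

/-- The functional equation determines its solution modulo each power of `z`. -/
lemma z_pow_dvd_sol_sub (N : ℕ) : z ^ N ∣ sol - partialSum N := by
  induction N with
  | zero => rw [pow_zero]; exact one_dvd _
  | succ N ih =>
    have ih1 : z ^ N ∣ solAtOne - partialSumAtOne N := by
      have := map_dvd atZero ih
      rwa [map_pow, map_sub, atZero_z, atZero_sol, atZero_partialSum] at this
    have hprod : z ^ N ∣ sol * (sol - solAtOne) - ∑ n ∈ range N, quadCoeff n * t ^ n := by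
      have h : sol * (sol - solAtOne) - ∑ n ∈ range N, quadCoeff n * t ^ n =
          (sol - partialSum N) * (sol - solAtOne) + partialSum N * (sol - partialSum N) -
            partialSum N * (solAtOne - partialSumAtOne N) +
            (partialSum N * (partialSum N - partialSumAtOne N) -
              ∑ n ∈ range N, quadCoeff n * t ^ n) := by ring
      rw [h]
      exact (((ih.mul_right _).add (ih.mul_left _)).sub (ih1.mul_left _)).add
        (z_pow_dvd_sub_quadCoeff N)
    refine Prime.pow_dvd_of_dvd_mul_left X_prime (N + 1) not_z_dvd_x_sub_one ?_
    have h : (x - 1) * (sol - partialSum (N + 1)) =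
        x * (t * (sol * (sol - solAtOne) - ∑ n ∈ range N, quadCoeff n * t ^ n)) := by
      rw [mul_sub, sol_eq, sub_one_mul_partialSum]
      ring
    rw [h]
    exact ((pow_succ' z N).dvd.trans (mul_dvd_mul z_dvd_t hprod)).mul_left x

end ParamSeries

open ParamSeries in
/-- The univariate generating function of trees, at `X * (1 - X) ^ 3`, is
`(1 - 2 * X) / (1 - X) ^ 3`. -/
lemma X_pow_dvd_sum_card_trees (N : ℕ) : (X : PowerSeries ℚ) ^ N ∣
    (1 - X) ^ 3 * ∑ n ∈ range N, C (#(LTree.trees n) : ℚ) * (X * (1 - X) ^ 3) ^ n -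
      (1 - 2 * X) := by
  have h := map_dvd atZero (z_pow_dvd_sol_sub N)
  rw [map_pow, map_sub, atZero_z, atZero_sol, atZero_partialSum] at h
  have h2 : z ^ N ∣ (1 - z) ^ 3 * partialSumAtOne N - (1 - 2 * z) := by
    have hr : (1 - z) ^ 3 * r ^ 3 = 1 := by rw [← mul_pow, mul_r, one_pow]
    convert h.mul_left (-(1 - z) ^ 3) using 1
    rw [solAtOne]
    linear_combination (1 - 2 * z) * hr
  have h3 := map_dvd (PowerSeries.map (Polynomial.evalRingHom (0 : ℚ))) h2
  have hz : PowerSeries.map (Polynomial.evalRingHom (0 : ℚ)) z = X := by simp [z]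
  have hC : ∀ q : ℚ, PowerSeries.map (Polynomial.evalRingHom (0 : ℚ))
      (algebraMap ℚ ParamSeries q) = C q := by
    intro q
    simp [PowerSeries.algebraMap_apply]
  have h4 : PowerSeries.map (Polynomial.evalRingHom (0 : ℚ)) 2 = 2 := map_ofNat _ 2
  simpa [partialSumAtOne, t, hz, hC, h4, LTree.eval_one_degPoly] using h3

lemma eq_zero_of_X_pow_dvd_sum {d : ℕ → ℚ}
    (h : ∀ N, (X : PowerSeries ℚ) ^ N ∣ ∑ n ∈ range N, C (d n) * (X * (1 - X) ^ 3) ^ n) (n : ℕ) :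
    d n = 0 := by
  induction n using Nat.strong_induction_on with
  | _ n ih =>
    have h1 := h (n + 1)
    rw [sum_range_succ, sum_eq_zero (fun k hk => by simp [ih k (mem_range.1 hk)]), zero_add,
      mul_pow, mul_left_comm, pow_succ, mul_dvd_mul_iff_left (pow_ne_zero _ X_ne_zero),
      X_dvd_iff] at h1
    simpa using h1

lemma card_trees (n : ℕ) : (#(LTree.trees n) : ℚ) = fishCount n := by
  refine sub_eq_zero.1 (eq_zero_of_X_pow_dvd_sum
    (d := fun n => (#(LTree.trees n) : ℚ) - fishCount n) (fun N => ?_) n)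
  have h : ¬ (X : PowerSeries ℚ) ∣ (1 - X) ^ 3 := by simp [X_dvd_iff]
  refine Prime.pow_dvd_of_dvd_mul_left X_prime N h ?_
  convert (X_pow_dvd_sum_card_trees N).sub (X_pow_dvd_sum_fishCount N) using 1
  simp only [map_sub, sub_mul, sum_sub_distrib]
  ring

end Parametrization

end FightingFish

theorem mainTheorem6 (n : ℕ) (hn : 1 ≤ n) :
    ((FightingFish.extendedFightingFish n).ncard : ℚ) =
      2 / ((n : ℚ) * ((n : ℚ) + 1)) * ((4 * n + 1).choose (n - 1) : ℚ) := by
  rw [FightingFish.ncard_extendedFightingFish hn, FightingFish.LTree.setOf_valid_eq_trees,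
    Set.ncard_coe_finset, FightingFish.card_trees, FightingFish.fishCount_eq hn]
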